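/- Let $X(t)$, $t\in\mathbb R$, be a real-valued, mean-square continuous, (wide-sense) stationary random process with $\mathbf E X(t)=0$ and finite second moments, let $\mathbf B(\tau)=\mathbf E X(t+\tau)X(t)$ be its covariance function, and let $F$ be its spectral function, i.e. a bounded nondecreasing function with $\mathbf B(\tau)=\int_{-\infty}^{\infty}e^{i\tau\lambda}\,dF(\lambda)$ for all $\tau\in\mathbb R$. Let $0<\Lambda<\omega$, $z\in(0,1)$, $t>0$, and let $n$ be an integer with $n\ge \frac{\omega t}{\pi\sqrt z}$. Put \[X_n(t):=\sum_{k=-n}^{n}\frac{\sin\left(\omega\left(t-\frac{k\pi}{\omega}\right)\right)}{\omega\left(t-\frac{k\pi}{\omega}\right)}\,X\!\left(\frac{k\pi}{\omega}\right),\] where $\frac{\sin x}{x}$ is read as $1$ at $x=0$. Then \[\left(\mathbf E\left|X(t)-X_n(t)\right|^2\right)^{1/2}\le A_n(t,\Lambda),\] where \[A_n(t,\Lambda):=\frac{\sqrt{C_n(t,\Lambda)}}{n}+D_n(t)\left(\int_{|\lambda|>\Lambda}dF(\lambda)\right)^{1/2},\] \[C_n(t,\Lambda):=\mathbf B(0)\left(\frac{4\omega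 t}{\pi^2(1-z)}+\frac{4\left(z+1+\frac1n\right)}{\pi(1-z)^2\left(1-\frac{\Lambda}{\omega}\right)}\right)^2,\] \[D_n(t):=2+\frac{2|\sin(\omega t)|}{\pi}\left(1+\mathrm{Si}(\pi)+\frac{\frac{\omega t}{\pi}+0.5}{n-\frac{\omega t}{\pi}}\right),\qquad \mathrm{Si}(\pi)=\int_0^{\pi}\frac{\sin x}{x}\,dx.\] -/

import Mathlib

open MeasureTheory Filter Topology

noncomputable section

/-- A real-valued, zero-mean, mean-square continuous second-order process `X` on the real line that
is stationary in the wide sense (every second-order strictly stationary process is of this kind). -/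
structure IsStationaryProcess {Ω : Type*} [MeasurableSpace Ω] (P : Measure Ω)
    (X : ℝ → Ω → ℝ) : Prop where
  /-- finite second moments -/
  memLp : ∀ t, MemLp (X t) 2 P
  /-- zero mean -/
  mean_zero : ∀ t, ∫ a, X t a ∂P = 0
  /-- `E X(t + τ) X(t)` does not depend on `t` -/
  stationary : ∀ s t τ, ∫ a, X (s + τ) a * X s a ∂P = ∫ a, X (t + τ) a * X t a ∂P
  /-- mean-square continuity -/
  continuous : ∀ t, Tendsto (fun s => ∫ a, (X s a - X t a) ^ 2 ∂P) (𝓝 t) (𝓝 0)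

/-- The covariance function `B(τ) = E X(t + τ) X(t)`, written at `t = 0`. -/
def covFun {Ω : Type*} [MeasurableSpace Ω] (P : Measure Ω) (X : ℝ → Ω → ℝ) (τ : ℝ) : ℝ :=
  ∫ a, X (0 + τ) a * X 0 a ∂P

/-- The Lebesgue-Stieltjes measure `dF` of a nondecreasing function `F`. -/
def stieltjesMeasure {F : ℝ → ℝ} (hF : Monotone F) : Measure ℝ :=
  hF.stieltjesFunction.measure

/-- The nondecreasing function `F` is a spectral function of a process with covariance function
`B`: it is bounded and `B(τ) = ∫ exp(i τ x) dF(x)` for all real `τ`. -/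
structure IsSpectralFunction (B : ℝ → ℝ) {F : ℝ → ℝ} (hF : Monotone F) : Prop where
  bddBelow : BddBelow (Set.range F)
  bddAbove : BddAbove (Set.range F)
  repr : ∀ τ : ℝ, (B τ : ℂ) = ∫ x, Complex.exp (Complex.I * τ * x) ∂(stieltjesMeasure hF)

/-- The truncated Whittaker-Kotel'nikov-Shannon expansion `X_n(t)`.  `Real.sinc x` is `sin x / x`,
with its continuous value `1` at `x = 0`. -/
def truncatedWKS {Ω : Type*} (X : ℝ → Ω → ℝ) (ω : ℝ) (n : ℕ) (t : ℝ) (a : Ω) : ℝ :=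
  ∑ k ∈ Finset.Icc (-(n : ℤ)) (n : ℤ),
    Real.sinc (ω * (t - k * Real.pi / ω)) * X (k * Real.pi / ω) a

/-- The sine integral `Si(x)`, the integral of `sin y / y` from `0` to `x`. -/
def sinIntegral (x : ℝ) : ℝ := ∫ y in (0 : ℝ)..x, Real.sinc y

/-- The constant `C_n(t, Λ)`. -/
def boundC (B : ℝ → ℝ) (z ω : ℝ) (n : ℕ) (t Λ : ℝ) : ℝ :=
  B 0 * (4 * ω * t / (Real.pi ^ 2 * (1 - z))
    + 4 * (z + 1 + 1 / (n : ℝ)) / (Real.pi * (1 - z) ^ 2 * (1 - Λ / ω))) ^ 2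

/-- The constant `D_n(t)`. -/
def boundD (ω : ℝ) (n : ℕ) (t : ℝ) : ℝ :=
  2 + 2 * |Real.sin (ω * t)| / Real.pi *
    (1 + sinIntegral Real.pi
      + (ω * t / Real.pi + 0.5) / ((n : ℝ) - ω * t / Real.pi))

/-- The error bound `A_n(t, Λ)`. -/
def boundA (B : ℝ → ℝ) {F : ℝ → ℝ} (hF : Monotone F) (z ω : ℝ) (n : ℕ) (t Λ : ℝ) : ℝ :=
  √(boundC B z ω n t Λ) / n
    + boundD ω n t * √(∫ _x in {x : ℝ | Λ < |x|}, (1 : ℝ) ∂(stieltjesMeasure hF))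

end

/-! By the spectral representation, the mean-square error is the `L²(dF)` norm of the deterministic
error of the truncated cardinal series of `exp (i a θ)`, with `a = ω t / π`, `θ = π x / ω` and
samples at the integers (`integral_sq_sub_truncatedWKS`). Two bounds for that error are combined by
splitting at `|x| = Λ` (`sqrt_integral_sq_le`).

For `|x| ≤ Λ`, `θ` stays away from `±π`. Multiplication by `1 + exp (i θ)` removes the jump of the
periodized exponential: adjacent coefficients of alternating sign combine into telescoping
differences, so the tail is `O(1/n)`, and `|1 + exp (i θ)|` is bounded below
(`norm_exp_sub_sum_sinc_le`).

For `|x| > Λ` only a bound uniform in `θ` is available (`norm_sum_sinc_le`). Centring the sum at the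
integer nearest to `a` and pairing opposite indices reduces it to the sums of `sin (j x) / j`, whose
absolute values never exceed `Si(π)` (`abs_sum_sin_div_le`). -/

/-! ### Covariance and spectral measure. -/

/-- The covariance of two values of a stationary process. -/
theorem IsStationaryProcess.integral_mul {Ω : Type*} [MeasurableSpace Ω] {P : Measure Ω}
    {X : ℝ → Ω → ℝ} (hX : IsStationaryProcess P X) (p q : ℝ) :
    ∫ a, X p a * X q a ∂P = covFun P X (p - q) := by
  have h := hX.stationary q 0 (p - q)
  rwa [add_sub_cancel] at h

theorem IsStationaryProcess.memLp_sum {Ω ι : Type*} [MeasurableSpace Ω] {P : Measure Ω}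
    {X : ℝ → Ω → ℝ} (hX : IsStationaryProcess P X) (s : Finset ι) (c p : ι → ℝ) :
    MemLp (fun a => ∑ i ∈ s, c i * X (p i) a) 2 P :=
  memLp_finsetSum s fun i _ => (hX.memLp (p i)).const_mul (c i)

theorem IsStationaryProcess.integral_sq_sum {Ω ι : Type*} [MeasurableSpace Ω] {P : Measure Ω}
    {X : ℝ → Ω → ℝ} (hX : IsStationaryProcess P X) (s : Finset ι) (c p : ι → ℝ) :
    ∫ a, (∑ i ∈ s, c i * X (p i) a) ^ 2 ∂P
      = ∑ i ∈ s, ∑ j ∈ s, c i * c j * covFun P X (p i - p j) := by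
  have hint (i j : ι) : Integrable (fun a => c i * c j * (X (p i) a * X (p j) a)) P :=
    ((hX.memLp (p i)).integrable_mul (hX.memLp (p j))).const_mul _
  have h (a : Ω) : (∑ i ∈ s, c i * X (p i) a) ^ 2
      = ∑ i ∈ s, ∑ j ∈ s, c i * c j * (X (p i) a * X (p j) a) := by
    rw [sq, Finset.sum_mul_sum]
    exact Finset.sum_congr rfl fun i _ => Finset.sum_congr rfl fun j _ => by ring
  simp_rw [h]
  rw [integral_finsetSum _ fun i _ => integrable_finsetSum _ fun j _ => hint i j]
  refine Finset.sum_congr rfl fun i _ => ?_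
  rw [integral_finsetSum _ fun j _ => hint i j]
  refine Finset.sum_congr rfl fun j _ => ?_
  rw [integral_const_mul, hX.integral_mul]

theorem IsSpectralFunction.isFiniteMeasure {B F : ℝ → ℝ} {hF : Monotone F}
    (h : IsSpectralFunction B hF) : IsFiniteMeasure (stieltjesMeasure hF) := by
  obtain ⟨l, hl⟩ := h.bddBelow
  obtain ⟨u, hu⟩ := h.bddAbove
  refine hF.stieltjesFunction.isFiniteMeasure_of_forall_abs_le (C := max |l| |u|) fun x => ?_
  -- The Stieltjes function is the right limit of `F`, so its value at `x` lies between `F x` and `F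
  -- (x + 1)`.
  have h1 : l ≤ hF.stieltjesFunction x := by
    rw [Monotone.stieltjesFunction_eq]
    exact (hl ⟨x, rfl⟩).trans (hF.le_rightLim le_rfl)
  have h2 : hF.stieltjesFunction x ≤ u := by
    rw [Monotone.stieltjesFunction_eq]
    exact (hF.rightLim_le (lt_add_one x)).trans (hu ⟨x + 1, rfl⟩)
  exact abs_le_max_abs_abs h1 h2

theorem IsSpectralFunction.apply_zero {B F : ℝ → ℝ} {hF : Monotone F}
    (h : IsSpectralFunction B hF) : B 0 = (stieltjesMeasure hF).real Set.univ := by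
  have h0 := h.repr 0
  simp only [Complex.ofReal_zero, mul_zero, zero_mul, Complex.exp_zero, integral_const,
    Complex.real_smul, mul_one] at h0
  exact_mod_cast h0

/-- The quadratic form of the covariance function in terms of the spectral measure. -/
theorem IsSpectralFunction.integral_norm_sq_sum {ι : Type*} {B F : ℝ → ℝ} {hF : Monotone F}
    (h : IsSpectralFunction B hF) (s : Finset ι) (c p : ι → ℝ) :
    ∫ x : ℝ, ‖∑ i ∈ s, (c i : ℂ) * Complex.exp (Complex.I * p i * x)‖ ^ 2 ∂(stieltjesMeasure hF)
      = ∑ i ∈ s, ∑ j ∈ s, c i * c j * B (p i - p j) := by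
  have := h.isFiniteMeasure
  have hint (i j : ι) : Integrable (fun x : ℝ =>
      (c i * c j : ℂ) * Complex.exp (Complex.I * (p i - p j : ℝ) * x)) (stieltjesMeasure hF) := by
    refine Integrable.const_mul (Integrable.of_bound (C := 1)
      (by fun_prop : Continuous _).aestronglyMeasurable ?_) _
    refine ae_of_all _ fun x => ?_
    rw [show Complex.I * (p i - p j : ℝ) * x = ((p i - p j) * x : ℝ) * Complex.I by
      push_cast; ring, Complex.norm_exp_ofReal_mul_I]
  apply Complex.ofReal_injective
  rw [← integral_complex_ofReal]
  have hx (x : ℝ) :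
      ((‖∑ i ∈ s, (c i : ℂ) * Complex.exp (Complex.I * p i * x)‖ ^ 2 : ℝ) : ℂ)
      = ∑ i ∈ s, ∑ j ∈ s, (c i * c j : ℂ) * Complex.exp (Complex.I * (p i - p j : ℝ) * x) := by
    rw [Complex.ofReal_pow, ← Complex.mul_conj', map_sum, Finset.sum_mul_sum]
    refine Finset.sum_congr rfl fun i _ => Finset.sum_congr rfl fun j _ => ?_
    rw [map_mul, Complex.conj_ofReal, ← Complex.exp_conj, map_mul, map_mul, Complex.conj_I,
      Complex.conj_ofReal, Complex.conj_ofReal, mul_mul_mul_comm, ← Complex.exp_add]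
    congr 2
    push_cast
    ring
  simp_rw [hx]
  rw [integral_finsetSum _ fun i _ => integrable_finsetSum _ fun j _ => hint i j, Complex.ofReal_sum]
  refine Finset.sum_congr rfl fun i _ => ?_
  rw [integral_finsetSum _ fun j _ => hint i j, Complex.ofReal_sum]
  refine Finset.sum_congr rfl fun j _ => ?_
  rw [integral_const_mul, ← h.repr]
  push_cast
  ring

/-! ### Cardinal series of the exponential away from `±π`. -/

theorem integral_exp_ofReal_mul_I_eq_sinc (b : ℝ) :
    ∫ x in -Real.pi..Real.pi, Complex.exp (b * x * Complex.I)
      = 2 * Real.pi * Real.sinc (Real.pi * b) := by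
  rcases eq_or_ne b 0 with rfl | hb
  · simp; ring
  have h := intervalIntegral.integral_comp_mul_left
    (fun x : ℝ => Complex.exp (x * Complex.I)) hb (a := -Real.pi) (b := Real.pi)
  simp only [Complex.ofReal_mul] at h
  rw [h, show b * -Real.pi = -(Real.pi * b) by ring, mul_comm b,
    integral_exp_mul_I_eq_sinc, Complex.real_smul]
  have : (b : ℂ) ≠ 0 := by exact_mod_cast hb
  push_cast
  field_simp

theorem sinc_pi_mul_sub_intCast {a : ℝ} {k : ℤ} (h : a ≠ k) :
    Real.sinc (Real.pi * (a - k)) = (-1) ^ k * Real.sin (Real.pi * a) / (Real.pi * (a - k)) := by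
  rw [Real.sinc_of_ne_zero (mul_ne_zero Real.pi_ne_zero (sub_ne_zero.2 h)),
    mul_sub, mul_comm Real.pi (k : ℝ), Real.sin_sub_int_mul_pi]

theorem abs_sinc_pi_mul_sub_intCast {a : ℝ} {k : ℤ} (h : a ≠ k) :
    |Real.sinc (Real.pi * (a - k))| = |Real.sin (Real.pi * a)| / Real.pi / |a - k| := by
  rw [sinc_pi_mul_sub_intCast h, abs_div, abs_mul, abs_mul, abs_zpow, abs_neg, abs_one, one_zpow,
    one_mul, abs_of_pos Real.pi_pos, div_div]

theorem abs_sinc_add_sinc {a : ℝ} {k : ℤ} (h : a ≠ k) (h' : a ≠ (k - 1 : ℤ)) :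
    |Real.sinc (Real.pi * (a - k)) + Real.sinc (Real.pi * (a - (k - 1 : ℤ)))|
      = |Real.sin (Real.pi * a)| / Real.pi * |1 / (a - k) - 1 / (a - (k - 1 : ℤ))| := by
  rw [sinc_pi_mul_sub_intCast h, sinc_pi_mul_sub_intCast h', zpow_sub_one₀ (by norm_num)]
  have h1 := sub_ne_zero.2 h
  have h2 := sub_ne_zero.2 h'
  rw [show (-1 : ℝ) ^ k * Real.sin (Real.pi * a) / (Real.pi * (a - k))
      + (-1) ^ k * (-1)⁻¹ * Real.sin (Real.pi * a) / (Real.pi * (a - (k - 1 : ℤ)))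
      = (-1) ^ k * (Real.sin (Real.pi * a) / Real.pi
        * (1 / (a - k) - 1 / (a - (k - 1 : ℤ)))) by field_simp; ring]
  rw [abs_mul, abs_mul, abs_div, abs_zpow, abs_neg, abs_one, one_zpow, one_mul,
    abs_of_pos Real.pi_pos]

/-- The Fourier coefficients of `(1 + exp (i x)) exp (i a x)` on `[-π, π]`. -/
noncomputable def wksCoeff (a : ℝ) (k : ℤ) : ℝ :=
  Real.sinc (Real.pi * (a - k)) + Real.sinc (Real.pi * (a - (k - 1 : ℤ)))

theorem abs_wksCoeff_right {a : ℝ} {j : ℕ} (ha : |a| < j) :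
    |wksCoeff a (j + 1)|
      = |Real.sin (Real.pi * a)| / Real.pi * (1 / (j - a) - 1 / ((j + 1 : ℕ) - a)) := by
  have h := (abs_lt.1 ha).2
  rw [wksCoeff, abs_sinc_add_sinc (by push_cast; linarith) (by push_cast; linarith)]
  congr 1
  push_cast
  rw [show 1 / (a - (j + 1 : ℝ)) - 1 / (a - ((j : ℝ) + 1 - 1)) = 1 / (j - a) - 1 / (j + 1 - a) by
    have h1 : a - (j + 1 : ℝ) ≠ 0 := by linarith
    have h2 : a - j ≠ 0 := by linarith
    have h3 : (j : ℝ) - a ≠ 0 := by linarith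
    have h4 : (j : ℝ) + 1 - a ≠ 0 := by linarith
    rw [add_sub_cancel_right]
    field_simp
    ring]
  refine abs_of_nonneg (sub_nonneg.2 (one_div_le_one_div_of_le ?_ ?_)) <;> linarith

theorem abs_wksCoeff_left {a : ℝ} {j : ℕ} (ha : |a| < j) :
    |wksCoeff a (-(j + 1))| = |Real.sin (Real.pi * a)| / Real.pi
      * (1 / (a + (j + 1)) - 1 / (a + ((j + 1 : ℕ) + 1))) := by
  have h := (abs_lt.1 ha).1
  rw [wksCoeff, abs_sinc_add_sinc (by push_cast; linarith) (by push_cast; linarith)]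
  congr 1
  push_cast
  rw [show a - -(j + 1 : ℝ) = a + (j + 1) by ring,
    show a - (-(j + 1 : ℝ) - 1) = a + (j + 1 + 1) by ring]
  refine abs_of_nonneg (sub_nonneg.2 (one_div_le_one_div_of_le ?_ ?_)) <;> linarith

theorem sum_Icc_neg_succ {E : Type*} [AddCommMonoid E] (f : ℤ → E) (n : ℕ) :
    ∑ k ∈ Finset.Icc (-((n + 1 : ℕ) : ℤ)) ((n + 1 : ℕ) : ℤ), f k
      = ∑ k ∈ Finset.Icc (-(n : ℤ)) (n : ℤ), f k + (f (n + 1) + f (-(n + 1))) := by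
  have h : Finset.Icc (-((n + 1 : ℕ) : ℤ)) ((n + 1 : ℕ) : ℤ)
      = insert ((n : ℤ) + 1) (insert (-((n : ℤ) + 1)) (Finset.Icc (-(n : ℤ)) (n : ℤ))) := by
    ext k
    simp only [Finset.mem_Icc, Finset.mem_insert]
    push_cast
    omega
  rw [h, Finset.sum_insert, Finset.sum_insert]
  · rw [← add_assoc, add_comm]
  · simp only [Finset.mem_Icc]; omega
  · simp only [Finset.mem_Icc, Finset.mem_insert]; omega

/-- On each side, far enough out, the absolute values are a constant times consecutive differences
of a nonnegative sequence, so their partial sums telescope and stay bounded. -/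
theorem summable_wksCoeff (a : ℝ) : Summable (wksCoeff a) := by
  obtain ⟨m, hm⟩ := exists_nat_gt |a|
  have hlt (j : ℕ) : |a| < (m + j : ℕ) := by push_cast; linarith [(Nat.cast_nonneg j : (0:ℝ) ≤ j)]
  set s := |Real.sin (Real.pi * a)| / Real.pi
  have hs : 0 ≤ s := by positivity
  have htel (b : ℕ → ℝ) (hb : ∀ j, 0 ≤ b j) (u : ℕ → ℝ) (hu : ∀ j, |u j| = s * (b j - b (j + 1))) :
      Summable u := by
    refine Summable.of_norm (summable_of_sum_range_le (c := s * b 0) (fun _ => norm_nonneg _) ?_)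
    intro N
    simp_rw [Real.norm_eq_abs, hu]
    rw [← Finset.mul_sum, Finset.sum_range_sub']
    have := hb N
    gcongr
    linarith
  refine Summable.of_nat_of_neg ?_ ?_
  · rw [← summable_nat_add_iff (m + 1)]
    refine htel (fun j => 1 / ((m + j : ℕ) - a)) (fun j => ?_) _ fun j => ?_
    · have := (abs_lt.1 (hlt j)).2
      exact one_div_nonneg.2 (by linarith)
    · rw [show ((j + (m + 1) : ℕ) : ℤ) = ((m + j : ℕ) : ℤ) + 1 by push_cast; ring,
        abs_wksCoeff_right (hlt j)]
      rfl
  · rw [← summable_nat_add_iff (m + 1)]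
    refine htel (fun j => 1 / (a + ((m + j : ℕ) + 1))) (fun j => ?_) _ fun j => ?_
    · have := (abs_lt.1 (hlt j)).1
      exact one_div_nonneg.2 (by linarith)
    · rw [show -((j + (m + 1) : ℕ) : ℤ) = -(((m + j : ℕ) : ℤ) + 1) by push_cast; ring,
        abs_wksCoeff_left (hlt j)]
      rfl

/-- The factor `1 + exp (i θ)` vanishes at `±π`, so the product extends continuously to the circle;
with summable Fourier coefficients its series then converges pointwise. -/
theorem hasSum_wksCoeff (a : ℝ) {θ : ℝ} (hθ : |θ| < Real.pi) :
    HasSum (fun k : ℤ => (wksCoeff a k : ℂ) * Complex.exp (k * θ * Complex.I))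
      ((1 + Complex.exp (θ * Complex.I)) * Complex.exp (a * θ * Complex.I)) := by
  have : Fact (0 < 2 * Real.pi) := ⟨by positivity⟩
  let f : ℝ → ℂ := fun x => (1 + Complex.exp (x * Complex.I)) * Complex.exp (a * x * Complex.I)
  have hend : f (-Real.pi) = f (-Real.pi + 2 * Real.pi) := by
    have h1 : -Real.pi + 2 * Real.pi = Real.pi := by ring
    have h2 : Complex.exp (-(Real.pi * Complex.I)) = -1 := by
      rw [Complex.exp_neg, Complex.exp_pi_mul_I]; norm_num
    simp only [f, h1, Complex.exp_pi_mul_I, Complex.ofReal_neg, neg_mul, h2]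
    simp
  have hc : Continuous f := by fun_prop
  let g : C(AddCircle (2 * Real.pi), ℂ) :=
    ⟨AddCircle.liftIco (2 * Real.pi) (-Real.pi) f,
      AddCircle.liftIco_continuous hend hc.continuousOn⟩
  have hcoeff (k : ℤ) : fourierCoeff g k = wksCoeff a k := by
    change fourierCoeff (AddCircle.liftIco (2 * Real.pi) (-Real.pi) f) k = _
    rw [fourierCoeff_liftIco_eq, fourierCoeffOn_eq_integral]
    have hi (x : ℝ) : fourier (-k) (x : AddCircle (-Real.pi + 2 * Real.pi - -Real.pi)) • f x
        = Complex.exp ((a - k : ℝ) * x * Complex.I)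
          + Complex.exp ((a - (k - 1 : ℤ) : ℝ) * x * Complex.I) := by
      rw [fourier_coe_apply, smul_eq_mul]
      simp only [f]
      rw [add_mul, one_mul, mul_add, ← Complex.exp_add, ← Complex.exp_add, ← Complex.exp_add]
      have hpi : (Real.pi : ℂ) ≠ 0 := by exact_mod_cast Real.pi_ne_zero
      have h2 : -(Real.pi : ℂ) + 2 * Real.pi - -Real.pi = 2 * Real.pi := by ring
      push_cast
      rw [h2]
      congr 2 <;> field_simp <;> ring
    simp_rw [hi]
    have hii (b : ℝ) : IntervalIntegrable (fun x : ℝ => Complex.exp (b * x * Complex.I)) volume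
        (-Real.pi) Real.pi := Continuous.intervalIntegrable (by fun_prop) _ _
    rw [show -Real.pi + 2 * Real.pi = Real.pi by ring, intervalIntegral.integral_add (hii _) (hii _),
      integral_exp_ofReal_mul_I_eq_sinc, integral_exp_ofReal_mul_I_eq_sinc, wksCoeff,
      Complex.real_smul]
    have hpi : (Real.pi : ℂ) ≠ 0 := by exact_mod_cast Real.pi_ne_zero
    push_cast
    field_simp
    ring
  have hsum : Summable (fourierCoeff g) := by
    simp_rw [funext hcoeff]
    exact_mod_cast summable_wksCoeff a
  have h := has_pointwise_sum_fourier_series_of_summable hsum (θ : AddCircle (2 * Real.pi))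
  obtain ⟨h1, h2⟩ := abs_lt.1 hθ
  have hg : g (θ : AddCircle (2 * Real.pi)) = f θ :=
    AddCircle.liftIco_coe_apply (f := f) (a := -Real.pi) ⟨h1.le, by linarith⟩
  rw [hg] at h
  convert h using 2 with k
  rw [hcoeff, fourier_coe_apply, smul_eq_mul]
  congr 2
  have hpi : (Real.pi : ℂ) ≠ 0 := by exact_mod_cast Real.pi_ne_zero
  push_cast
  field_simp

/-- The subtracted terms in `K` make the induction exact: each new pair of coefficients contributes
precisely one telescoping difference. -/
theorem norm_sum_wksCoeff_sub_le {a θ : ℝ} {n K : ℕ} (ha : |a| < n) (hK : n ≤ K) :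
    ‖∑ k ∈ Finset.Icc (-(K : ℤ)) K, (wksCoeff a k : ℂ) * Complex.exp (k * θ * Complex.I)
        - ∑ k ∈ Finset.Icc (-(n : ℤ)) n, (wksCoeff a k : ℂ) * Complex.exp (k * θ * Complex.I)‖
      ≤ |Real.sin (Real.pi * a)| / Real.pi * ((1 / (n - a) + 1 / (a + (n + 1)))
        - (1 / (K - a) + 1 / (a + (K + 1)))) := by
  induction K, hK using Nat.le_induction with
  | base => simp
  | succ K hK ih =>
    have hlt : |a| < K := ha.trans_le (by exact_mod_cast hK)
    have hnorm (k : ℤ) :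
        ‖(wksCoeff a k : ℂ) * Complex.exp (k * θ * Complex.I)‖ = |wksCoeff a k| := by
      rw [norm_mul, show (k * θ * Complex.I : ℂ) = ((k * θ : ℝ) : ℂ) * Complex.I by push_cast; ring,
        Complex.norm_exp_ofReal_mul_I, mul_one, Complex.norm_real, Real.norm_eq_abs]
    rw [sum_Icc_neg_succ, add_sub_right_comm]
    refine (norm_add_le _ _).trans ((add_le_add ih (norm_add_le _ _)).trans (le_of_eq ?_))
    rw [hnorm, hnorm, abs_wksCoeff_right hlt, abs_wksCoeff_left hlt]
    ring

/-- Summation by parts: multiplying by `exp (i θ)` shifts the window by one, which leaves one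
boundary term at each end. -/
theorem one_add_exp_mul_sum_sinc (a θ : ℝ) (n : ℕ) :
    (1 + Complex.exp (θ * Complex.I)) * ∑ k ∈ Finset.Icc (-(n : ℤ)) n,
        (Real.sinc (Real.pi * (a - k)) : ℂ) * Complex.exp (k * θ * Complex.I)
      = ∑ k ∈ Finset.Icc (-(n : ℤ)) n, (wksCoeff a k : ℂ) * Complex.exp (k * θ * Complex.I)
        + (Real.sinc (Real.pi * (a - n)) : ℂ) * Complex.exp ((n + 1) * θ * Complex.I)
        - (Real.sinc (Real.pi * (a + (n + 1))) : ℂ) * Complex.exp (-n * θ * Complex.I) := by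
  induction n with
  | zero =>
    simp only [Nat.cast_zero, neg_zero, Finset.Icc_self, Finset.sum_singleton, wksCoeff]
    push_cast
    simp only [zero_mul, Complex.exp_zero, sub_zero]
    rw [show a - -1 = a + (0 + 1) by ring]
    simp only [zero_add, one_mul]
    ring
  | succ n ih =>
    rw [sum_Icc_neg_succ, sum_Icc_neg_succ, mul_add, ih]
    simp only [wksCoeff]
    push_cast
    rw [show a - (-(n + 1 : ℝ) - 1) = a + (n + 1 + 1) by ring,
      show a - -(n + 1 : ℝ) = a + (n + 1) by ring, show a - ((n : ℝ) + 1 - 1) = a - n by ring,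
      show ((n : ℂ) + 1 + 1) * θ * Complex.I = (n + 1) * θ * Complex.I + θ * Complex.I by ring,
      show -(n : ℂ) * θ * Complex.I = -(n + 1) * θ * Complex.I + θ * Complex.I by ring,
      Complex.exp_add, Complex.exp_add]
    ring

/-- The truncation error of the cardinal series of `exp (i a x)` at an interior point. -/
theorem norm_one_add_exp_mul_sub_le {a θ : ℝ} {n : ℕ} (ha : |a| < n) (hθ : |θ| < Real.pi) :
    ‖1 + Complex.exp (θ * Complex.I)‖ * ‖Complex.exp (a * θ * Complex.I)
        - ∑ k ∈ Finset.Icc (-(n : ℤ)) n,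
          (Real.sinc (Real.pi * (a - k)) : ℂ) * Complex.exp (k * θ * Complex.I)‖
      ≤ |Real.sin (Real.pi * a)| / Real.pi * (2 * (1 / (n - a) + 1 / (a + (n + 1)))) := by
  obtain ⟨ha1, ha2⟩ := abs_lt.1 ha
  rw [← norm_mul, mul_sub, one_add_exp_mul_sum_sinc]
  have htail : ‖(1 + Complex.exp (θ * Complex.I)) * Complex.exp (a * θ * Complex.I)
      - ∑ k ∈ Finset.Icc (-(n : ℤ)) n, (wksCoeff a k : ℂ) * Complex.exp (k * θ * Complex.I)‖
      ≤ |Real.sin (Real.pi * a)| / Real.pi * (1 / (n - a) + 1 / (a + (n + 1))) := by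
    have h := (hasSum_wksCoeff a hθ).comp (Finset.tendsto_Icc_neg (R := ℤ))
    refine le_of_tendsto (h.sub_const _).norm ?_
    filter_upwards [eventually_ge_atTop n] with K hK
    refine (norm_sum_wksCoeff_sub_le ha hK).trans ?_
    have hK' : (n : ℝ) ≤ K := by exact_mod_cast hK
    have h1 : 0 ≤ 1 / ((K : ℝ) - a) := one_div_nonneg.2 (by linarith)
    have h2 : 0 ≤ 1 / (a + ((K : ℝ) + 1)) := one_div_nonneg.2 (by linarith)
    gcongr
    linarith
  have h1 : ‖(Real.sinc (Real.pi * (a - n)) : ℂ) * Complex.exp ((n + 1) * θ * Complex.I)‖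
      = |Real.sin (Real.pi * a)| / Real.pi * (1 / (n - a)) := by
    have h := abs_sinc_pi_mul_sub_intCast (a := a) (k := n) (by push_cast; linarith)
    push_cast at h
    rw [norm_mul, show ((n + 1) * θ * Complex.I : ℂ) = (((n + 1) * θ : ℝ) : ℂ) * Complex.I by
      push_cast; ring, Complex.norm_exp_ofReal_mul_I, mul_one, Complex.norm_real, Real.norm_eq_abs,
      h, abs_sub_comm, abs_of_pos (by linarith : (0 : ℝ) < n - a), mul_one_div]
  have h2 : ‖(Real.sinc (Real.pi * (a + (n + 1))) : ℂ) * Complex.exp (-n * θ * Complex.I)‖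
      = |Real.sin (Real.pi * a)| / Real.pi * (1 / (a + (n + 1))) := by
    have h := abs_sinc_pi_mul_sub_intCast (a := a) (k := -(n + 1)) (by push_cast; linarith)
    push_cast at h
    rw [sub_neg_eq_add] at h
    rw [norm_mul, show (-n * θ * Complex.I : ℂ) = ((-n * θ : ℝ) : ℂ) * Complex.I by
      push_cast; ring, Complex.norm_exp_ofReal_mul_I, mul_one, Complex.norm_real, Real.norm_eq_abs,
      h, abs_of_pos (by linarith : (0 : ℝ) < a + (n + 1)), mul_one_div]
  -- The two boundary terms together are exactly as large as the tail bound, whence the factor 2.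
  rw [add_sub_assoc, ← sub_sub]
  refine (norm_sub_le _ _).trans ((add_le_add htail (norm_sub_le _ _)).trans (le_of_eq ?_))
  rw [h1, h2]
  ring

/-! ### Partial sums of `sin (j x) / j` and the sine integral. -/

/-- The difference `p` vanishes at both `0` and `π`. Its derivative is `y * s y` with `s` concave,
`s 0 = 0` and `s π < 0`, so `p` first increases and then decreases. -/
theorem cube_div_le_sin_sub_mul_cos {y : ℝ} (h0 : 0 ≤ y) (h1 : y ≤ Real.pi) :
    y ^ 3 / Real.pi ^ 2 ≤ Real.sin y - y * Real.cos y := by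
  set p : ℝ → ℝ := fun y => Real.sin y - y * Real.cos y - y ^ 3 / Real.pi ^ 2
  set s : ℝ → ℝ := fun y => Real.sin y - 3 / Real.pi ^ 2 * y
  have hp (y : ℝ) : HasDerivAt p (y * s y) y := by
    have h := ((Real.hasDerivAt_sin y).sub ((hasDerivAt_id y).mul (Real.hasDerivAt_cos y))).sub
      ((hasDerivAt_pow 3 y).div_const (Real.pi ^ 2))
    refine h.congr_deriv ?_
    simp only [s, id]
    push_cast
    ring
  have hpc : Continuous p := by fun_prop
  have hs : ConcaveOn ℝ (Set.Icc 0 Real.pi) s := by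
    refine strictConcaveOn_sin_Icc.concaveOn.sub ?_
    exact (LinearMap.mul ℝ ℝ (3 / Real.pi ^ 2)).convexOn (convex_Icc _ _)
  have hs0 : s 0 = 0 := by simp [s]
  have hspi : s Real.pi < 0 := by
    simp only [s, Real.sin_pi]
    have := Real.pi_pos
    have : 0 < 3 / Real.pi ^ 2 * Real.pi := by positivity
    linarith
  suffices 0 ≤ p y by simp only [p] at this; linarith
  by_cases hy : 0 ≤ s y
  · have hmono : MonotoneOn p (Set.Icc 0 y) := by
      refine monotoneOn_of_deriv_nonneg (convex_Icc _ _) hpc.continuousOn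
        (fun x _ => (hp x).differentiableAt.differentiableWithinAt) fun x hx => ?_
      rw [interior_Icc] at hx
      rw [(hp x).deriv]
      refine mul_nonneg hx.1.le ?_
      have := hs.min_le_of_mem_Icc (x := 0) (y := y) (z := x) ⟨le_rfl, Real.pi_pos.le⟩ ⟨h0, h1⟩
        ⟨hx.1.le, hx.2.le⟩
      rwa [hs0, min_eq_left hy] at this
    have := hmono ⟨le_rfl, h0⟩ ⟨h0, le_rfl⟩ h0
    simpa [p] using this
  · push Not at hy
    have hanti : AntitoneOn p (Set.Icc y Real.pi) := by
      refine antitoneOn_of_deriv_nonpos (convex_Icc _ _) hpc.continuousOn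
        (fun x _ => (hp x).differentiableAt.differentiableWithinAt) fun x hx => ?_
      rw [interior_Icc] at hx
      rw [(hp x).deriv]
      refine mul_nonpos_of_nonneg_of_nonpos (h0.trans hx.1.le) ?_
      by_contra! hsx
      have := hs.min_le_of_mem_Icc (x := 0) (y := x) (z := y) ⟨le_rfl, Real.pi_pos.le⟩
        ⟨h0.trans hx.1.le, hx.2.le⟩ ⟨h0, hx.1.le⟩
      rw [hs0, min_eq_left hsx.le] at this
      linarith
    have := hanti ⟨le_rfl, h1⟩ ⟨h1, le_rfl⟩ h1
    refine le_trans (le_of_eq ?_) this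
    have := Real.pi_ne_zero
    simp only [p, Real.sin_pi, Real.cos_pi]
    field_simp
    ring

/-- A quantitative decrease of `sinc`: the room left for the quadratic term becomes the gain in the
Riemann-sum comparison below. -/
theorem antitoneOn_sinc_add_sq :
    AntitoneOn (fun y => Real.sinc y + y ^ 2 / (2 * Real.pi ^ 2)) (Set.Icc 0 Real.pi) := by
  refine antitoneOn_of_hasDerivWithinAt_nonpos
    (f' := fun y => (Real.cos y * y - Real.sin y * 1) / y ^ 2 + (2 : ℕ) * y ^ 1 / (2 * Real.pi ^ 2))
    (convex_Icc _ _) (by have := Real.continuous_sinc; fun_prop) (fun y hy => ?_) fun y hy => ?_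
  all_goals rw [interior_Icc] at hy
  · refine HasDerivAt.hasDerivWithinAt ?_
    refine HasDerivAt.add ?_ ((hasDerivAt_pow 2 y).div_const _)
    refine ((Real.hasDerivAt_sin y).div (hasDerivAt_id y) hy.1.ne').congr_of_eventuallyEq ?_
    filter_upwards [eventually_ne_nhds hy.1.ne'] with x hx
    simp [Real.sinc_of_ne_zero hx]
  · have h := cube_div_le_sin_sub_mul_cos hy.1.le hy.2.le
    have hy0 := hy.1
    have hpi := Real.pi_pos
    have : (Real.cos y * y - Real.sin y * 1) / y ^ 2 ≤ -(y ^ 3 / Real.pi ^ 2) / y ^ 2 := by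
      gcongr
      linarith
    refine (add_le_add_left this _).trans (le_of_eq ?_)
    field_simp
    push_cast
    ring

theorem sum_range_succ_sq (M : ℕ) :
    ∑ i ∈ Finset.range M, ((i + 1 : ℕ) : ℝ) ^ 2 = M * (M + 1) * (2 * M + 1) / 6 := by
  induction M with
  | zero => simp
  | succ M ih => rw [Finset.sum_range_succ, ih]; push_cast; ring

theorem sinc_nonneg {y : ℝ} (h0 : 0 ≤ y) (h1 : y ≤ Real.pi) : 0 ≤ Real.sinc y := by
  rcases h0.eq_or_lt with rfl | h0
  · simp
  · rw [Real.sinc_of_ne_zero h0.ne']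
    exact div_nonneg (Real.sin_nonneg_of_nonneg_of_le_pi h0.le h1) h0.le

theorem sinIntegral_le_sinIntegral_pi {x : ℝ} (h0 : 0 ≤ x) (h1 : x ≤ Real.pi) :
    sinIntegral x ≤ sinIntegral Real.pi := by
  have hi (a b : ℝ) : IntervalIntegrable Real.sinc volume a b :=
    Real.continuous_sinc.intervalIntegrable a b
  have h := intervalIntegral.integral_add_adjacent_intervals (hi 0 x) (hi x Real.pi)
  have h2 : 0 ≤ ∫ y in x..Real.pi, Real.sinc y :=
    intervalIntegral.integral_nonneg h1 fun y hy => sinc_nonneg (h0.trans hy.1) hy.2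
  simp only [sinIntegral]
  linarith

/-- The sum of the nonnegative terms `sin (j x) / j`, with the gain over the sine integral that
comes from replacing the integral by a Riemann sum. -/
theorem sum_sin_div_add_le_sinIntegral {x : ℝ} (hx : 0 < x) {M : ℕ} (hM : M * x ≤ Real.pi) :
    ∑ i ∈ Finset.range M, Real.sin ((i + 1 : ℕ) * x) / (i + 1 : ℕ)
      + x ^ 3 * (3 * M ^ 2 + M) / (12 * Real.pi ^ 2) ≤ sinIntegral Real.pi := by
  have hpi := Real.pi_pos
  have hanti : AntitoneOn (fun u : ℝ => Real.sinc (x * u) + (x * u) ^ 2 / (2 * Real.pi ^ 2))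
      (Set.Icc 0 (0 + (M : ℝ))) := by
    intro u hu v hv huv
    have hle {w : ℝ} (hw : w ∈ Set.Icc 0 (0 + (M : ℝ))) : x * w ∈ Set.Icc 0 Real.pi := by
      rw [zero_add] at hw
      refine ⟨mul_nonneg hx.le hw.1, le_trans ?_ hM⟩
      rw [mul_comm]
      exact mul_le_mul_of_nonneg_right hw.2 hx.le
    exact antitoneOn_sinc_add_sq (hle hu) (hle hv) (by gcongr)
  -- A right-endpoint Riemann sum of a decreasing function lies below the integral. For the
  -- quadratic part the sum exceeds the integral, and the excess is the gain `h7`.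
  have h := hanti.sum_le_integral
  have hc := Real.continuous_sinc
  rw [intervalIntegral.integral_add (Continuous.intervalIntegrable (by fun_prop) _ _)
    (Continuous.intervalIntegrable (by fun_prop) _ _), intervalIntegral.integral_comp_mul_left _ hx.ne',
    Finset.sum_add_distrib] at h
  have h2 : ∫ u in (0 : ℝ)..0 + M, (x * u) ^ 2 / (2 * Real.pi ^ 2)
      = x ^ 2 * M ^ 3 / (6 * Real.pi ^ 2) := by
    simp_rw [mul_pow, mul_div_right_comm]
    rw [intervalIntegral.integral_const_mul, integral_pow]
    field_simp
    push_cast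
    ring
  have h3 : ∑ i ∈ Finset.range M, (x * (0 + ((i + 1 : ℕ) : ℝ))) ^ 2 / (2 * Real.pi ^ 2)
      = x ^ 2 * (M * (M + 1) * (2 * M + 1)) / (12 * Real.pi ^ 2) := by
    simp_rw [zero_add, mul_pow]
    rw [← Finset.sum_div, ← Finset.mul_sum, sum_range_succ_sq]
    field_simp
    ring
  have h4 : x * ∑ i ∈ Finset.range M, Real.sinc (x * (0 + ((i + 1 : ℕ) : ℝ)))
      = ∑ i ∈ Finset.range M, Real.sin ((i + 1 : ℕ) * x) / (i + 1 : ℕ) := by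
    rw [Finset.mul_sum]
    refine Finset.sum_congr rfl fun i _ => ?_
    have hi : ((i + 1 : ℕ) : ℝ) ≠ 0 := by positivity
    rw [zero_add, Real.sinc_of_ne_zero (mul_ne_zero hx.ne' hi), mul_comm x ((i + 1 : ℕ) : ℝ)]
    field_simp
  rw [h2, h3, mul_zero, zero_add, smul_eq_mul] at h
  have h5 := mul_le_mul_of_nonneg_left h hx.le
  rw [mul_add x, h4, mul_add x (x⁻¹ * _), mul_inv_cancel_left₀ hx.ne'] at h5
  have h6 := sinIntegral_le_sinIntegral_pi (x := x * M) (by positivity) (by rwa [mul_comm])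
  rw [sinIntegral] at h6
  refine le_trans (le_of_sub_nonneg ?_) h6
  have h7 : x ^ 3 * (3 * M ^ 2 + M) / (12 * Real.pi ^ 2)
      = x * (x ^ 2 * (M * (M + 1) * (2 * M + 1)) / (12 * Real.pi ^ 2))
        - x * (x ^ 2 * M ^ 3 / (6 * Real.pi ^ 2)) := by
    field_simp
    ring
  linarith

theorem one_le_sinIntegral_pi : 1 ≤ sinIntegral Real.pi := by
  have h := sum_sin_div_add_le_sinIntegral (x := Real.pi / 2) (M := 1) (by positivity)
    (by push_cast; linarith [Real.pi_pos])
  simp only [Finset.range_one, Finset.sum_singleton, zero_add, Nat.cast_one, one_mul,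
    Real.sin_pi_div_two, div_one] at h
  have : 0 ≤ (Real.pi / 2) ^ 3 * (3 * 1 ^ 2 + 1) / (12 * Real.pi ^ 2) := by positivity
  linarith

/-- This is `tan v ≤ 4 v / π`; the difference of the two sides is concave and vanishes at both ends
of the interval. -/
theorem pi_mul_sin_le {v : ℝ} (h0 : 0 ≤ v) (h1 : v ≤ Real.pi / 4) :
    Real.pi * Real.sin v ≤ 4 * v * Real.cos v := by
  have hconc : ConcaveOn ℝ (Set.Icc 0 (Real.pi / 4))
      (fun v => 4 * v * Real.cos v - Real.pi * Real.sin v) := by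
    have hd (v : ℝ) : HasDerivAt (fun v => 4 * v * Real.cos v - Real.pi * Real.sin v)
        ((4 - Real.pi) * Real.cos v - 4 * v * Real.sin v) v := by
      have h := (((hasDerivAt_id v).const_mul 4).mul (Real.hasDerivAt_cos v)).sub
        ((Real.hasDerivAt_sin v).const_mul Real.pi)
      refine h.congr_deriv ?_
      simp only [id]
      ring
    refine AntitoneOn.concaveOn_of_deriv (convex_Icc _ _) (by fun_prop)
      (fun x _ => (hd x).differentiableAt.differentiableWithinAt) ?_
    intro u hu v hv huv
    rw [interior_Icc] at hu hv
    rw [(hd u).deriv, (hd v).deriv]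
    have hpi := Real.pi_lt_four
    have hpi0 := Real.pi_pos
    have hc : Real.cos v ≤ Real.cos u :=
      Real.cos_le_cos_of_nonneg_of_le_pi hu.1.le (by linarith [hv.2]) huv
    have hs : Real.sin u ≤ Real.sin v :=
      Real.sin_le_sin_of_le_of_le_pi_div_two (by linarith [hu.1]) (by linarith [hv.2]) huv
    have hs0 : 0 ≤ Real.sin u := Real.sin_nonneg_of_nonneg_of_le_pi hu.1.le (by linarith [hu.2])
    have h1 := mul_le_mul_of_nonneg_left hc (by linarith : 0 ≤ 4 - Real.pi)
    have h2 := mul_le_mul huv hs hs0 (hv.1.le)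
    linarith
  have hpi0 := Real.pi_pos
  have h := hconc.min_le_of_mem_Icc (x := 0) (y := Real.pi / 4) (z := v)
    ⟨le_rfl, by positivity⟩ ⟨by positivity, le_rfl⟩ ⟨h0, h1⟩
  simp only [Real.cos_pi_div_four, Real.sin_pi_div_four, Real.sin_zero] at h
  have : 4 * (Real.pi / 4) * (√2 / 2) - Real.pi * (√2 / 2) = 0 := by ring
  rw [this] at h
  simp at h
  linarith

/-- Abel's inequality for a nonnegative decreasing weight. -/
theorem sum_mul_le_of_antitone {f w : ℕ → ℝ} {C : ℝ} (hw : Antitone w) (hw0 : ∀ k, 0 ≤ w k)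
    (hf : ∀ N, ∑ i ∈ Finset.range N, f i ≤ C) (N : ℕ) :
    ∑ i ∈ Finset.range N, w i * f i ≤ w 0 * C := by
  have key : ∀ N, ∑ i ∈ Finset.range N, w i * f i
      = w N * ∑ i ∈ Finset.range N, f i
        + ∑ i ∈ Finset.range N, (w i - w (i + 1)) * ∑ j ∈ Finset.range (i + 1), f j := by
    intro N
    induction N with
    | zero => simp
    | succ N ih =>
      rw [Finset.sum_range_succ, ih, Finset.sum_range_succ (n := N)
        (f := fun i => (w i - w (i + 1)) * ∑ j ∈ Finset.range (i + 1), f j),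
        Finset.sum_range_succ f]
      ring
  rw [key]
  calc _ ≤ w N * C + ∑ i ∈ Finset.range N, (w i - w (i + 1)) * C := by
        gcongr with i hi
        · exact hw0 N
        · exact hf N
        · exact sub_nonneg.2 (hw (Nat.le_succ i))
        · exact hf _
    _ = w 0 * C := by
        rw [← Finset.sum_mul, Finset.sum_range_sub', ← add_mul]
        ring

theorem two_mul_sin_mul_sum_sin (x : ℝ) (M N : ℕ) :
    2 * Real.sin (x / 2) * ∑ i ∈ Finset.range N, Real.sin ((M + i + 1 : ℕ) * x)
      = Real.cos ((M + 1 / 2) * x) - Real.cos ((M + N + 1 / 2) * x) := by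
  induction N with
  | zero => simp
  | succ N ih =>
    rw [Finset.sum_range_succ, mul_add, ih]
    have h : Real.cos ((M + N + 1 / 2) * x) - Real.cos ((M + (N + 1 : ℕ) + 1 / 2) * x)
        = 2 * Real.sin (x / 2) * Real.sin ((M + N + 1 : ℕ) * x) := by
      rw [Real.cos_sub_cos]
      push_cast
      rw [show ((M + N + 1 / 2) * x + (M + (N + 1) + 1 / 2) * x) / 2 = (M + N + 1 : ℝ) * x by ring,
        show ((M + N + 1 / 2) * x - (M + (N + 1) + 1 / 2) * x) / 2 = -(x / 2) by ring, Real.sin_neg]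
      ring
    linarith

/-- The factor `c` is taken as `1` or `-1`, so one application of Abel's inequality serves for the
upper and the lower bound. -/
theorem sum_sin_div_tail_le {x C : ℝ} (M : ℕ) (c : ℝ)
    (h : ∀ N, c * ∑ i ∈ Finset.range N, Real.sin ((M + i + 1 : ℕ) * x) ≤ C) (N : ℕ) :
    c * ∑ i ∈ Finset.range N, Real.sin ((M + i + 1 : ℕ) * x) / (M + i + 1 : ℕ) ≤ C / (M + 1) := by
  have hw : Antitone fun i : ℕ => 1 / ((M + i + 1 : ℕ) : ℝ) := fun i j hij => by
    dsimp only
    gcongr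
  have := sum_mul_le_of_antitone (f := fun i => c * Real.sin ((M + i + 1 : ℕ) * x)) hw
    (fun k => by positivity) (fun N => by rw [← Finset.mul_sum]; exact h N) N
  rw [Finset.mul_sum]
  convert this using 1
  · exact Finset.sum_congr rfl fun i _ => by ring
  · push_cast; ring

/-- The first `M = ⌊π / x⌋` terms are nonnegative and stay below `Si(π)` by a definite gain. Abel
summation shows that the remaining terms add at most this gain and subtract at most `1 ≤ Si(π)`. -/
theorem abs_sum_sin_div_le_of_mem {x : ℝ} (h0 : 0 < x) (h1 : x ≤ Real.pi) (N : ℕ) :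
    |∑ i ∈ Finset.range N, Real.sin ((i + 1 : ℕ) * x) / (i + 1 : ℕ)| ≤ sinIntegral Real.pi := by
  have hpi := Real.pi_pos
  set M := ⌊Real.pi / x⌋₊ with hM
  have hMle : M * x ≤ Real.pi := (le_div_iff₀ h0).1 (Nat.floor_le (by positivity))
  have hMlt : Real.pi < (M + 1) * x := (div_lt_iff₀ h0).1 (Nat.lt_floor_add_one _)
  have hM1 : 1 ≤ M := Nat.le_floor (by rw [Nat.cast_one]; exact (one_le_div h0).2 h1)
  have hnn {K : ℕ} (hK : K ≤ M) :
      0 ≤ ∑ i ∈ Finset.range K, Real.sin ((i + 1 : ℕ) * x) / (i + 1 : ℕ) := by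
    refine Finset.sum_nonneg fun i hi => div_nonneg ?_ (by positivity)
    refine Real.sin_nonneg_of_nonneg_of_le_pi (by positivity) (le_trans ?_ hMle)
    have := Finset.mem_range.1 hi
    gcongr
    omega
  have hgain {K : ℕ} : 0 ≤ x ^ 3 * (3 * K ^ 2 + K) / (12 * Real.pi ^ 2) := by positivity
  rcases le_total N M with hN | hN
  · rw [abs_of_nonneg (hnn hN)]
    have h := sum_sin_div_add_le_sinIntegral h0 (M := N) (le_trans (by gcongr) hMle)
    linarith [hgain (K := N)]
  obtain ⟨L, rfl⟩ := Nat.exists_eq_add_of_le hN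
  rw [Finset.sum_range_add]
  have hsin : 0 < Real.sin (x / 2) := Real.sin_pos_of_pos_of_lt_pi (by linarith) (by linarith)
  have hhead := sum_sin_div_add_le_sinIntegral h0 hMle
  have hM1' : (1 : ℝ) ≤ M := by exact_mod_cast hM1
  refine abs_le.2 ⟨?_, ?_⟩
  · have htail := sum_sin_div_tail_le (x := x) (C := Real.pi / x) M (-1) (fun N => ?_) L
    · have : Real.pi / x / (M + 1) ≤ 1 := by
        rw [div_div, div_le_one (by positivity)]
        linarith
      linarith [hnn le_rfl, one_le_sinIntegral_pi]
    · have h := two_mul_sin_mul_sum_sin x M N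
      have hs : x / Real.pi ≤ Real.sin (x / 2) := by
        have := Real.mul_le_sin (x := x / 2) (by linarith) (by linarith)
        refine le_trans (le_of_eq ?_) this
        field_simp
      rw [neg_one_mul, neg_le, ← mul_le_mul_iff_right₀ (by positivity : 0 < 2 * Real.sin (x / 2)), h]
      have h2 : 2 * (x / Real.pi) * (Real.pi / x) ≤ 2 * Real.sin (x / 2) * (Real.pi / x) := by gcongr
      have h3 : 2 * (x / Real.pi) * (Real.pi / x) = 2 := by field_simp
      linarith [Real.neg_one_le_cos ((M + 1 / 2) * x), Real.cos_le_one ((M + N + 1 / 2) * x)]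
  · have htail := sum_sin_div_tail_le (x := x) (C := x / (2 * Real.pi)) M 1
      (fun N => ?_) L
    · have : x / (2 * Real.pi) / (M + 1) ≤ x ^ 3 * (3 * M ^ 2 + M) / (12 * Real.pi ^ 2) := by
        rw [div_div, div_le_div_iff₀ (by positivity) (by positivity)]
        have h3 := Real.pi_gt_three
        have e1 : Real.pi * Real.pi ≤ ((M + 1) * x) * ((M + 1) * x) := by gcongr
        -- Equality at `M = 1`: the gain covers the tail because `π > 3`.
        have e2 : (6 : ℝ) * (M + 1) ≤ (3 * M ^ 2 + M) * 3 := by nlinarith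
        have e3 : 6 * Real.pi ≤ x ^ 2 * (3 * M ^ 2 + M) * (M + 1) := by
          have e4 := mul_le_mul_of_nonneg_right e1 (by positivity : (0 : ℝ) ≤ 3 * M ^ 2 + M)
          have e5 : Real.pi * (6 * (M + 1)) ≤ Real.pi * ((3 * M ^ 2 + M) * Real.pi) := by
            refine mul_le_mul_of_nonneg_left (e2.trans ?_) hpi.le
            gcongr
          refine le_of_mul_le_mul_right (a := (M : ℝ) + 1) ?_ (by positivity)
          linarith
        nlinarith [mul_le_mul_of_nonneg_left e3 (by positivity : 0 ≤ 2 * x * Real.pi)]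
      linarith
    · have h := two_mul_sin_mul_sum_sin x M N
      -- By the choice of `M`, `(M + 1/2) x` is within `x / 2` of `π`. The sine sum is then at most
      -- `tan (x / 4) / 2 ≤ x / (2 π)`.
      have hcos : Real.cos ((M + 1 / 2) * x) ≤ - Real.cos (x / 2) := by
        have h2 : Real.cos (x / 2) ≤ Real.cos |(M + 1 / 2) * x - Real.pi| :=
          Real.cos_le_cos_of_nonneg_of_le_pi (abs_nonneg _) (by linarith)
            (abs_le.2 ⟨by linarith, by linarith⟩)
        rw [Real.cos_abs, Real.cos_sub_pi] at h2
        linarith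
      have hv := pi_mul_sin_le (v := x / 4) (by linarith) (by linarith)
      rw [one_mul, ← mul_le_mul_iff_right₀ (by positivity : 0 < 2 * Real.sin (x / 2)), h]
      have hB := Real.neg_one_le_cos ((M + N + 1 / 2) * x)
      have hs4 : 0 ≤ Real.sin (x / 4) :=
        Real.sin_nonneg_of_nonneg_of_le_pi (by linarith) (by linarith)
      have h2 : Real.cos (x / 2) = 1 - 2 * Real.sin (x / 4) ^ 2 := by
        rw [show x / 2 = 2 * (x / 4) by ring, Real.cos_two_mul, Real.cos_sq']
        ring
      have h3 : 2 * Real.sin (x / 2) * (x / (2 * Real.pi))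
          = 2 * Real.sin (x / 4) * (4 * (x / 4) * Real.cos (x / 4)) / Real.pi := by
        rw [show x / 2 = 2 * (x / 4) by ring, Real.sin_two_mul]
        field_simp
      have h4 : 2 * Real.sin (x / 4) ^ 2 ≤ 2 * Real.sin (x / 2) * (x / (2 * Real.pi)) := by
        rw [h3, le_div_iff₀ hpi]
        have := mul_le_mul_of_nonneg_left hv (by positivity : 0 ≤ 2 * Real.sin (x / 4))
        linarith
      linarith

theorem abs_sum_sin_div_le (x : ℝ) (N : ℕ) :
    |∑ i ∈ Finset.range N, Real.sin ((i + 1 : ℕ) * x) / (i + 1 : ℕ)| ≤ sinIntegral Real.pi := by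
  obtain ⟨k, y, hy, hxy⟩ : ∃ (k : ℤ) (y : ℝ), |y| ≤ Real.pi ∧ x = y + k * (2 * Real.pi) := by
    have h2 : (0 : ℝ) < 2 * Real.pi := by positivity
    have h := toIocMod_mem_Ioc h2 (-Real.pi) x
    refine ⟨toIocDiv h2 (-Real.pi) x, toIocMod h2 (-Real.pi) x,
      abs_le.2 ⟨h.1.le, by linarith [h.2]⟩, ?_⟩
    rw [← zsmul_eq_mul, toIocMod_add_toIocDiv_zsmul]
  have hsin (i : ℕ) : Real.sin ((i + 1 : ℕ) * x) = Real.sin ((i + 1 : ℕ) * y) := by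
    rw [hxy, show ((i + 1 : ℕ) : ℝ) * (y + k * (2 * Real.pi))
      = (i + 1 : ℕ) * y + (((i + 1 : ℕ) : ℤ) * k : ℤ) * (2 * Real.pi) by push_cast; ring,
      Real.sin_add_int_mul_two_pi]
  simp_rw [hsin]
  rcases lt_trichotomy y 0 with h | rfl | h
  · rw [abs_of_neg h] at hy
    have := abs_sum_sin_div_le_of_mem (neg_pos.2 h) hy N
    simpa [neg_div, abs_neg] using this
  · simpa using zero_le_one.trans one_le_sinIntegral_pi
  · rw [abs_of_pos h] at hy
    exact abs_sum_sin_div_le_of_mem h hy N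

/-! ### Uniform bound for the partial cardinal sums. -/

theorem sum_Icc_neg_eq {E : Type*} [AddCommMonoid E] (f : ℤ → E) (n : ℕ) :
    ∑ k ∈ Finset.Icc (-(n : ℤ)) (n : ℤ), f k
      = f 0 + ∑ j ∈ Finset.range n, (f (j + 1) + f (-(j + 1))) := by
  induction n with
  | zero => simp
  | succ n ih => rw [sum_Icc_neg_succ, ih, Finset.sum_range_succ, add_assoc]

/-- Splitting `j / (j² - δ²)` as `1 / j + δ² / (j (j² - δ²))` isolates a sine series with
coefficients free of `δ`; the shift of `θ` by `π` absorbs the alternating sign. -/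
theorem sinc_mul_exp_add_neg {δ θ : ℝ} (hδ : |δ| ≤ 1 / 2) (j : ℕ) :
    (Real.sinc (Real.pi * (δ - (j + 1 : ℤ))) : ℂ) * Complex.exp ((j + 1 : ℤ) * θ * Complex.I)
      + (Real.sinc (Real.pi * (δ - (-(j + 1) : ℤ))) : ℂ)
        * Complex.exp ((-(j + 1) : ℤ) * θ * Complex.I)
    = (-(2 * Real.sin (Real.pi * δ) / Real.pi) : ℝ)
      * ((Real.sin ((j + 1 : ℕ) * (θ + Real.pi)) / (j + 1 : ℕ) : ℝ) * Complex.I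
        + ((-1) ^ (j + 1) * δ / ((j + 1) ^ 2 - δ ^ 2) : ℝ) *
          (Real.cos ((j + 1) * θ) + (δ / (j + 1) : ℝ) * (Real.sin ((j + 1) * θ)) * Complex.I)) := by
  obtain ⟨h1, h2⟩ := abs_le.1 hδ
  have hj : (0 : ℝ) ≤ j := Nat.cast_nonneg j
  have hd1 : δ - (j + 1) ≠ 0 := by linarith
  have hd2 : δ + (j + 1) ≠ 0 := by linarith
  have hd3 : ((j : ℝ) + 1) ^ 2 - δ ^ 2 ≠ 0 := by
    rw [show ((j : ℝ) + 1) ^ 2 - δ ^ 2 = -((δ - (j + 1)) * (δ + (j + 1))) by ring]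
    exact neg_ne_zero.2 (mul_ne_zero hd1 hd2)
  have hd4 : (j : ℝ) + 1 ≠ 0 := by positivity
  have hpi := Real.pi_ne_zero
  rw [sinc_pi_mul_sub_intCast (by push_cast; exact sub_ne_zero.1 hd1),
    sinc_pi_mul_sub_intCast (by push_cast; linarith)]
  have hz1 : (-1 : ℝ) ^ ((j : ℤ) + 1) = (-1) ^ (j + 1) := by exact_mod_cast zpow_natCast (-1 : ℝ) (j + 1)
  have hz2 : (-1 : ℝ) ^ (-((j : ℤ) + 1)) = (-1) ^ (j + 1) := by
    rw [zpow_neg, hz1, ← inv_pow]; norm_num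
  rw [hz1, hz2, mul_add ((j + 1 : ℕ) : ℝ) θ, Real.sin_add_nat_mul_pi]
  rw [show ((j + 1 : ℤ) * θ * Complex.I : ℂ) = (((j + 1) * θ : ℝ) : ℂ) * Complex.I by push_cast; ring,
    show ((-(j + 1) : ℤ) * θ * Complex.I : ℂ) = ((-((j + 1) * θ) : ℝ) : ℂ) * Complex.I by
      push_cast; ring]
  apply Complex.ext
  · simp only [Complex.add_re, Complex.re_ofReal_mul, Complex.exp_ofReal_mul_I_re, Real.cos_neg,
      Complex.mul_I_re, Complex.ofReal_im, Complex.ofReal_re, mul_assoc]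
    push_cast
    rw [show δ - -((j : ℝ) + 1) = δ + (j + 1) by ring]
    field_simp
    ring
  · simp only [Complex.add_im, Complex.im_ofReal_mul, Complex.exp_ofReal_mul_I_im, Real.sin_neg,
      Complex.mul_I_im, Complex.ofReal_im, Complex.ofReal_re, mul_assoc]
    push_cast
    rw [show δ - -((j : ℝ) + 1) = δ + (j + 1) by ring]
    field_simp
    ring

/-- The central term gives the leading `1`, the sine series gives `Si(π)`, and the corrections,
largest at `|δ| = 1/2`, telescope to at most `1`. -/
theorem norm_sum_sinc_symm_le {δ θ : ℝ} (hδ : |δ| ≤ 1 / 2) (N : ℕ) :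
    ‖∑ k ∈ Finset.Icc (-(N : ℤ)) N,
        (Real.sinc (Real.pi * (δ - k)) : ℂ) * Complex.exp (k * θ * Complex.I)‖
      ≤ 1 + 2 * |Real.sin (Real.pi * δ)| / Real.pi * (1 + sinIntegral Real.pi) := by
  have hpi := Real.pi_pos
  rw [sum_Icc_neg_eq]
  simp_rw [sinc_mul_exp_add_neg hδ]
  rw [← Finset.mul_sum, Finset.sum_add_distrib, ← Finset.sum_mul, ← Complex.ofReal_sum]
  refine (norm_add_le _ _).trans (add_le_add ?_ ?_)
  · simpa using Real.abs_sinc_le_one (Real.pi * δ)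
  rw [norm_mul, Complex.norm_real, Real.norm_eq_abs, abs_neg, abs_div, abs_mul, abs_two,
    abs_of_pos hpi, add_comm 1]
  refine mul_le_mul_of_nonneg_left ((norm_add_le _ _).trans (add_le_add ?_ ?_)) (by positivity)
  · rw [norm_mul, Complex.norm_I, mul_one, Complex.norm_real]
    exact abs_sum_sin_div_le (θ + Real.pi) N
  have hterm (j : ℕ) : ‖(((-1) ^ (j + 1) * δ / ((j + 1) ^ 2 - δ ^ 2) : ℝ) : ℂ) *
      (Real.cos ((j + 1) * θ) + (δ / (j + 1) : ℝ) * (Real.sin ((j + 1) * θ)) * Complex.I)‖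
      ≤ 1 / (2 * (j : ℝ) + 1) - 1 / (2 * (j + 1 : ℕ) + 1) := by
    have hj : (0 : ℝ) ≤ j := Nat.cast_nonneg j
    have hsq : δ ^ 2 ≤ 1 / 4 := by
      rw [← sq_abs]
      nlinarith [abs_nonneg δ]
    have h1 : ‖(Real.cos ((j + 1) * θ) : ℂ)
        + (δ / (j + 1) : ℝ) * (Real.sin ((j + 1) * θ)) * Complex.I‖ ≤ 1 := by
      rw [← Complex.ofReal_mul, Complex.norm_add_mul_I]
      refine Real.sqrt_le_one.2 ?_
      rw [mul_pow]
      have h2 : (δ / (j + 1)) ^ 2 ≤ 1 := by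
        rw [div_pow, div_le_one (by positivity)]
        nlinarith
      nlinarith [Real.sin_sq_add_cos_sq ((j + 1) * θ), sq_nonneg (Real.sin ((j + 1) * θ))]
    have hpos : 0 < ((j : ℝ) + 1) ^ 2 - δ ^ 2 := by nlinarith
    have hpos' : 0 < ((j : ℝ) + 1) ^ 2 - 1 / 4 := by nlinarith
    rw [norm_mul, Complex.norm_real, Real.norm_eq_abs, abs_div, abs_mul, abs_pow, abs_neg, abs_one,
      one_pow, one_mul, abs_of_pos hpos]
    calc _ ≤ |δ| / (((j : ℝ) + 1) ^ 2 - δ ^ 2) * 1 := by gcongr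
      _ ≤ (1 / 2) / (((j : ℝ) + 1) ^ 2 - 1 / 4) := by rw [mul_one]; gcongr
      _ = _ := by
        have : ((j : ℝ) + 1) ^ 2 - 1 / 4 = (2 * j + 1) * (2 * (j + 1) + 1) / 4 := by ring
        rw [this]
        push_cast
        field_simp
        ring
  refine (norm_sum_le_of_le _ fun j _ => hterm j).trans ?_
  rw [Finset.sum_range_sub' (fun j : ℕ => 1 / (2 * (j : ℝ) + 1))]
  have : 0 ≤ 1 / (2 * (N : ℝ) + 1) := by positivity
  simp only [Nat.cast_zero]
  linarith

/-- A bound for the partial sums of the cardinal series of `exp (i a x)` that is uniform in `x`. -/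
theorem norm_sum_sinc_le {a : ℝ} (θ : ℝ) {n : ℕ} (ha : 0 ≤ a) (han : a < n) :
    ‖∑ k ∈ Finset.Icc (-(n : ℤ)) n,
        (Real.sinc (Real.pi * (a - k)) : ℂ) * Complex.exp (k * θ * Complex.I)‖
      ≤ 1 + 2 * |Real.sin (Real.pi * a)| / Real.pi
        * (1 + sinIntegral Real.pi + (a + 1 / 2) / (n - a)) := by
  have hpi := Real.pi_pos
  have hnorm (k : ℤ) : ‖Complex.exp (k * θ * Complex.I)‖ = 1 := by
    rw [show (k * θ * Complex.I : ℂ) = ((k * θ : ℝ) : ℂ) * Complex.I by push_cast; ring,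
      Complex.norm_exp_ofReal_mul_I]
  obtain ⟨m, hm⟩ : ∃ m : ℕ, round a = m := by
    refine Int.eq_ofNat_of_zero_le ?_
    rw [round_eq]
    exact Int.floor_nonneg.2 (by linarith)
  have hδ := abs_sub_round a
  rw [hm, Int.cast_natCast] at hδ
  obtain ⟨hδ1, hδ2⟩ := abs_le.1 hδ
  have hmn : m ≤ n := by
    have : (m : ℝ) < n + 1 := by linarith
    exact Nat.lt_succ_iff.1 (by exact_mod_cast this)
  obtain ⟨N, rfl⟩ := Nat.exists_eq_add_of_le hmn
  set f : ℤ → ℂ := fun k =>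
    (Real.sinc (Real.pi * (a - k)) : ℂ) * Complex.exp (k * θ * Complex.I) with hf
  -- With `m` nearest to `a` and `n = m + N`, the window symmetric about `m` ends at `n`; the `2 m`
  -- leftover indices on the left are all at distance at least `n - a` from `a`.
  have hsplit : ∑ k ∈ Finset.Icc (-((m + N : ℕ) : ℤ)) ((m + N : ℕ) : ℤ), f k
      = ∑ k ∈ Finset.Ico (-((m + N : ℕ) : ℤ)) (m - N), f k
        + ∑ k ∈ Finset.Icc (m - N : ℤ) (m + N), f k := by
    rw [← Finset.sum_union]
    · congr 1
      ext k
      simp only [Finset.mem_union, Finset.mem_Icc, Finset.mem_Ico]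
      push_cast
      omega
    · refine Finset.disjoint_left.2 fun k => ?_
      simp only [Finset.mem_Icc, Finset.mem_Ico]
      omega
  have hrem : ‖∑ k ∈ Finset.Ico (-((m + N : ℕ) : ℤ)) (m - N), f k‖
      ≤ 2 * |Real.sin (Real.pi * a)| / Real.pi * ((a + 1 / 2) / ((m + N : ℕ) - a)) := by
    have hgap : 0 < ((m + N : ℕ) : ℝ) - a := by linarith
    have hb : ∀ k ∈ Finset.Ico (-((m + N : ℕ) : ℤ)) (m - N),
        ‖f k‖ ≤ |Real.sin (Real.pi * a)| / Real.pi / ((m + N : ℕ) - a) := by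
      intro k hk
      have hk2 := (Finset.mem_Ico.1 hk).2
      have hk3 : (k : ℝ) + 1 ≤ m - N := by exact_mod_cast hk2
      have hgap2 : ((m + N : ℕ) : ℝ) - a ≤ a - k := by push_cast; linarith
      rw [hf, norm_mul, hnorm, mul_one, Complex.norm_real, Real.norm_eq_abs,
        abs_sinc_pi_mul_sub_intCast (by linarith), abs_of_pos (hgap.trans_le hgap2)]
      gcongr
    refine (norm_sum_le_of_le _ hb).trans ?_
    rw [Finset.sum_const, nsmul_eq_mul, Int.card_Ico]
    have hcard : (((m : ℤ) - N - -((m + N : ℕ) : ℤ)).toNat : ℝ) = 2 * m := by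
      have : ((m : ℤ) - N - -((m + N : ℕ) : ℤ)).toNat = 2 * m := by push_cast; omega
      rw [this]; push_cast; ring
    rw [hcard]
    calc _ ≤ (2 * (a + 1 / 2)) * (|Real.sin (Real.pi * a)| / Real.pi / ((m + N : ℕ) - a)) := by
          gcongr
          linarith
      _ = _ := by ring
  have hmain : ‖∑ k ∈ Finset.Icc (m - N : ℤ) (m + N), f k‖
      ≤ 1 + 2 * |Real.sin (Real.pi * a)| / Real.pi * (1 + sinIntegral Real.pi) := by
    have himg : Finset.Icc (m - N : ℤ) (m + N)
        = (Finset.Icc (-(N : ℤ)) N).image (fun k => (m : ℤ) + k) := by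
      rw [Finset.image_add_left_Icc]
      congr 1
    have hshift : ∑ k ∈ Finset.Icc (m - N : ℤ) (m + N), f k
        = Complex.exp ((m : ℤ) * θ * Complex.I) * ∑ k ∈ Finset.Icc (-(N : ℤ)) N,
          (Real.sinc (Real.pi * ((a - m) - k)) : ℂ) * Complex.exp (k * θ * Complex.I) := by
      rw [himg, Finset.sum_image (fun x _ y _ h => add_left_cancel h), Finset.mul_sum]
      refine Finset.sum_congr rfl fun k _ => ?_
      simp only [hf]
      push_cast
      rw [sub_sub, show ((m : ℂ) + k) * θ * Complex.I = m * θ * Complex.I + k * θ * Complex.I by ring,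
        Complex.exp_add]
      ring
    rw [hshift, norm_mul, hnorm, one_mul]
    refine (norm_sum_sinc_symm_le hδ N).trans (le_of_eq ?_)
    rw [mul_sub, mul_comm Real.pi (m : ℝ), Real.sin_sub_nat_mul_pi, abs_mul, abs_pow, abs_neg,
      abs_one, one_pow, one_mul]
  rw [hsplit]
  refine (norm_add_le _ _).trans ((add_le_add hrem hmain).trans (le_of_eq ?_))
  ring

/-! ### Low-frequency estimate and conclusion. -/

/-- The modulus is `2 cos (θ / 2)`, and the cosine lies above its chord on `[0, π / 2]`. -/
theorem two_mul_le_norm_one_add_exp {θ r : ℝ} (hr : r ≤ 1) (hθ : |θ| ≤ Real.pi * r) :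
    2 * (1 - r) ≤ ‖1 + Complex.exp (θ * Complex.I)‖ := by
  have hpi := Real.pi_pos
  have hθ2 : |θ| ≤ Real.pi := hθ.trans (by nlinarith)
  have h1 : 1 - r ≤ Real.cos (|θ| / 2) := by
    have h := Real.one_sub_mul_le_cos (x := |θ| / 2) (by positivity) (by linarith)
    refine le_trans ?_ h
    have : 2 / Real.pi * (|θ| / 2) ≤ 2 / Real.pi * (Real.pi * r / 2) := by gcongr
    have h3 : 2 / Real.pi * (Real.pi * r / 2) = r := by field_simp
    linarith
  have h2 : Real.cos (|θ| / 2) = Real.cos (θ / 2) := by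
    rw [← Real.cos_abs (θ / 2), abs_div, abs_two]
  have h3 : 1 + Complex.exp (θ * Complex.I)
      = ((2 * Real.cos (θ / 2) : ℝ) : ℂ) * Complex.exp ((θ / 2 : ℝ) * Complex.I) := by
    have h : (θ : ℂ) * Complex.I = (θ / 2 : ℝ) * Complex.I + (θ / 2 : ℝ) * Complex.I := by
      push_cast; ring
    rw [h, Complex.ofReal_mul, Complex.ofReal_cos, Complex.ofReal_ofNat, Complex.two_cos, add_mul,
      ← Complex.exp_add, ← Complex.exp_add]
    simp [add_comm]
  rw [h3, norm_mul, Complex.norm_exp_ofReal_mul_I, mul_one, Complex.norm_real, Real.norm_eq_abs]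
  refine le_trans ?_ (le_abs_self _)
  linarith

theorem norm_exp_sub_sum_sinc_le {a θ r z : ℝ} {n : ℕ} (ha : 0 < a) (hz : z < 1) (hr : r < 1)
    (haz : a ^ 2 ≤ z * n ^ 2) (hθ : |θ| ≤ Real.pi * r) :
    ‖Complex.exp (a * θ * Complex.I) - ∑ k ∈ Finset.Icc (-(n : ℤ)) n,
          (Real.sinc (Real.pi * (a - k)) : ℂ) * Complex.exp (k * θ * Complex.I)‖
      ≤ 2 / (Real.pi * n * (1 - z) * (1 - r)) := by
  have hpi := Real.pi_pos
  have hn : (0 : ℝ) < n := by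
    rcases Nat.eq_zero_or_pos n with rfl | h
    · norm_num at haz; nlinarith
    · exact_mod_cast h
  have han : a < n := lt_of_pow_lt_pow_left₀ 2 hn.le (by nlinarith [pow_pos hn 2])
  have h := norm_one_add_exp_mul_sub_le (a := a) (θ := θ) (n := n) (by rwa [abs_of_pos ha])
    (hθ.trans_lt (by nlinarith))
  have hc := two_mul_le_norm_one_add_exp hr.le hθ
  set e := ‖Complex.exp (a * θ * Complex.I) - ∑ k ∈ Finset.Icc (-(n : ℤ)) n,
          (Real.sinc (Real.pi * (a - k)) : ℂ) * Complex.exp (k * θ * Complex.I)‖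
  have he : 0 ≤ e := norm_nonneg _
  have hz' : 0 < 1 - z := by linarith
  have hr' : 0 < 1 - r := by linarith
  have hna : 0 < n - a := by linarith
  have hs : |Real.sin (Real.pi * a)| / Real.pi ≤ 1 / Real.pi := by
    gcongr
    exact Real.abs_sin_le_one _
  have h1 : 1 / (n - a) + 1 / (a + (n + 1)) ≤ 2 / (n * (1 - z)) := by
    calc 1 / (n - a) + 1 / (a + (n + 1)) ≤ 1 / (n - a) + 1 / (a + n) := by gcongr; linarith
      _ = 2 * n / (n ^ 2 - a ^ 2) := by
        rw [show (n : ℝ) ^ 2 - a ^ 2 = (n - a) * (a + n) by ring]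
        field_simp
        ring
      _ ≤ 2 * n / (n ^ 2 * (1 - z)) := by gcongr; linarith
      _ = _ := by field_simp
  have h2 : 2 * (1 - r) * e ≤ 1 / Real.pi * (2 * (2 / (n * (1 - z)))) := by
    refine (mul_le_mul_of_nonneg_right hc he).trans (h.trans ?_)
    gcongr
  rw [le_div_iff₀ (by positivity)]
  have h3 : 1 / Real.pi * (2 * (2 / (n * (1 - z)))) * (Real.pi * n * (1 - z)) = 4 := by field_simp; norm_num
  have h4 := mul_le_mul_of_nonneg_right h2 (by positivity : 0 ≤ Real.pi * n * (1 - z))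
  linarith

/-- Splitting of a mean-square error according to a set on which only a cruder bound holds. -/
theorem sqrt_integral_sq_le {α : Type*} [MeasurableSpace α] {μ : Measure α} [IsFiniteMeasure μ]
    {g : α → ℝ} {A : Set α} (hA : MeasurableSet A) (hg : AEStronglyMeasurable g μ) {c d : ℝ}
    (hc : 0 ≤ c) (hd : 0 ≤ d) (hg0 : ∀ x, 0 ≤ g x) (hgc : ∀ x ∉ A, g x ≤ c) (hgd : ∀ x, g x ≤ d) :
    √(∫ x, g x ^ 2 ∂μ) ≤ c * √(μ.real Set.univ) + d * √(μ.real A) := by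
  have hint : Integrable (fun x => g x ^ 2) μ := by
    refine Integrable.of_bound (hg.pow 2) (d ^ 2) (ae_of_all _ fun x => ?_)
    rw [Real.norm_eq_abs, abs_of_nonneg (sq_nonneg _)]
    exact pow_le_pow_left₀ (hg0 x) (hgd x) 2
  have h1 : ∫ x in A, g x ^ 2 ∂μ ≤ d ^ 2 * μ.real A := by
    refine (setIntegral_mono_on hint.integrableOn (integrableOn_const (measure_ne_top _ _)) hA
      fun x _ => pow_le_pow_left₀ (hg0 x) (hgd x) 2).trans (le_of_eq ?_)
    rw [setIntegral_const, smul_eq_mul, mul_comm]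
  have h2 : ∫ x in Aᶜ, g x ^ 2 ∂μ ≤ c ^ 2 * μ.real Set.univ := by
    refine (setIntegral_mono_on hint.integrableOn (integrableOn_const (measure_ne_top _ _)) hA.compl
      fun x hx => pow_le_pow_left₀ (hg0 x) (hgc x hx) 2).trans ?_
    rw [setIntegral_const, smul_eq_mul, mul_comm]
    exact mul_le_mul_of_nonneg_left (measureReal_mono (Set.subset_univ _)) (sq_nonneg c)
  rw [← integral_add_compl hA hint]
  refine (Real.sqrt_le_sqrt (add_le_add h1 h2)).trans ?_
  refine Real.sqrt_le_iff.2 ⟨by positivity, ?_⟩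
  have hU := Real.sq_sqrt (measureReal_nonneg (μ := μ) (s := Set.univ))
  have hS := Real.sq_sqrt (measureReal_nonneg (μ := μ) (s := A))
  have : 0 ≤ 2 * (c * √(μ.real Set.univ)) * (d * √(μ.real A)) := by positivity
  rw [add_sq, mul_pow, mul_pow, hU, hS]
  linarith

theorem IsStationaryProcess.integral_sq_sub_truncatedWKS {Ω : Type*} [MeasurableSpace Ω]
    {P : Measure Ω} {X : ℝ → Ω → ℝ} (hX : IsStationaryProcess P X)
    {F : ℝ → ℝ} {hF : Monotone F} (hspec : IsSpectralFunction (covFun P X) hF) {ω : ℝ} (hω : ω ≠ 0)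
    (n : ℕ) (t : ℝ) :
    MemLp (fun a => X t a - truncatedWKS X ω n t a) 2 P ∧
    ∫ a, (X t a - truncatedWKS X ω n t a) ^ 2 ∂P
      = ∫ x : ℝ, ‖Complex.exp ((ω * t / Real.pi : ℝ) * (Real.pi * x / ω : ℝ) * Complex.I)
        - ∑ k ∈ Finset.Icc (-(n : ℤ)) n, (Real.sinc (Real.pi * (ω * t / Real.pi - k)) : ℂ)
          * Complex.exp (k * (Real.pi * x / ω : ℝ) * Complex.I)‖ ^ 2 ∂(stieltjesMeasure hF) := by
  -- The index `none` stands for `X t` itself and `some k` for the samples, so the error is a single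
  -- linear combination.
  let c : Option ℤ → ℝ := fun i => i.elim 1 fun k => -Real.sinc (ω * (t - k * Real.pi / ω))
  let p : Option ℤ → ℝ := fun i => i.elim t fun k => k * Real.pi / ω
  let s := Finset.insertNone (Finset.Icc (-(n : ℤ)) n)
  have hsum (a : Ω) : X t a - truncatedWKS X ω n t a = ∑ i ∈ s, c i * X (p i) a := by
    simp [s, c, p, truncatedWKS, Finset.sum_insertNone, sub_eq_add_neg]
  simp_rw [hsum]
  refine ⟨hX.memLp_sum s c p, ?_⟩
  rw [hX.integral_sq_sum, ← hspec.integral_norm_sq_sum]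
  congr with x
  congr 2
  have hpi : (Real.pi : ℂ) ≠ 0 := by exact_mod_cast Real.pi_ne_zero
  have hω' : (ω : ℂ) ≠ 0 := by exact_mod_cast hω
  rw [Finset.sum_insertNone, sub_eq_add_neg, ← Finset.sum_neg_distrib]
  simp only [c, p, Option.elim]
  congr 1
  · rw [Complex.ofReal_one, one_mul]
    congr 1
    push_cast
    field_simp
  · refine Finset.sum_congr rfl fun k _ => ?_
    rw [Complex.ofReal_neg, neg_mul]
    congr 3
    · rw [show Real.pi * (ω * t / Real.pi - k) = ω * (t - k * Real.pi / ω) by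
        field_simp [Real.pi_ne_zero]]
    · push_cast
      field_simp

theorem theorem1 {Ω : Type*} [MeasurableSpace Ω] (P : Measure Ω) [IsProbabilityMeasure P]
    (X : ℝ → Ω → ℝ) (hX : IsStationaryProcess P X)
    (F : ℝ → ℝ) (hF : Monotone F) (hspec : IsSpectralFunction (covFun P X) hF)
    (Λ ω z t : ℝ) (n : ℕ) (hΛ : 0 < Λ) (hΛω : Λ < ω) (hz0 : 0 < z) (hz1 : z < 1) (ht : 0 < t)
    (hn : ω * t / (Real.pi * √z) ≤ n) :
    Integrable (fun a => |X t a - truncatedWKS X ω n t a| ^ 2) P ∧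
      √(∫ a, |X t a - truncatedWKS X ω n t a| ^ 2 ∂P)
        ≤ boundA (covFun P X) hF z ω n t Λ := by
  have hpi := Real.pi_pos
  have hω : 0 < ω := hΛ.trans hΛω
  have hfin := hspec.isFiniteMeasure
  obtain ⟨hmem, hEq⟩ := hX.integral_sq_sub_truncatedWKS hspec hω.ne' n t
  simp_rw [sq_abs]
  refine ⟨hmem.integrable_sq, ?_⟩
  rw [hEq]
  set b := ω * t / Real.pi with hb
  have hb0 : 0 < b := by positivity
  have hbn : b ≤ √z * n := by
    rw [← div_div, div_le_iff₀ (Real.sqrt_pos.2 hz0)] at hn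
    linarith
  have hbz : b ^ 2 ≤ z * n ^ 2 := by
    have := pow_le_pow_left₀ hb0.le hbn 2
    rwa [mul_pow, Real.sq_sqrt hz0.le] at this
  have hn0 : (0 : ℝ) < n := by
    by_contra! h
    nlinarith [Real.sqrt_nonneg z]
  have hbn' : b < n := by
    refine hbn.trans_lt ?_
    have : √z < 1 := by rw [Real.sqrt_lt' one_pos]; linarith
    nlinarith
  have hSi := one_le_sinIntegral_pi
  have hgap : 0 < n - b := by linarith
  have hz' : 0 < 1 - z := by linarith
  have hr : Λ / ω < 1 := (div_lt_one hω).2 hΛω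
  have hr' : 0 < 1 - Λ / ω := by linarith
  have hsin : Real.sin (ω * t) = Real.sin (Real.pi * b) := by
    congr 1; rw [hb]; field_simp
  set K := 4 * ω * t / (Real.pi ^ 2 * (1 - z))
    + 4 * (z + 1 + 1 / (n : ℝ)) / (Real.pi * (1 - z) ^ 2 * (1 - Λ / ω)) with hK
  have hK0 : 0 ≤ K := by positivity
  -- The low-frequency bound is sharper than required: the second summand of `K` alone dominates it.
  have hKle : 2 / (Real.pi * n * (1 - z) * (1 - Λ / ω)) ≤ K / n := by
    rw [le_div_iff₀ hn0]
    calc _ = 2 * (1 - z) / (Real.pi * (1 - z) ^ 2 * (1 - Λ / ω)) := by field_simp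
      _ ≤ 4 * (z + 1 + 1 / (n : ℝ)) / (Real.pi * (1 - z) ^ 2 * (1 - Λ / ω)) := by
        have : 0 < 1 / (n : ℝ) := by positivity
        have : 2 * (1 - z) ≤ 4 * (z + 1 + 1 / (n : ℝ)) := by linarith
        gcongr
      _ ≤ K := le_add_of_nonneg_left (by positivity)
  have hD0 : 0 ≤ boundD ω n t := by
    rw [boundD, ← hb]
    positivity
  have h := sqrt_integral_sq_le (μ := stieltjesMeasure hF) (A := {x : ℝ | Λ < |x|})
    (g := fun x : ℝ => ‖Complex.exp (b * (Real.pi * x / ω : ℝ) * Complex.I)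
        - ∑ k ∈ Finset.Icc (-(n : ℤ)) n, (Real.sinc (Real.pi * (b - k)) : ℂ)
          * Complex.exp (k * (Real.pi * x / ω : ℝ) * Complex.I)‖)
    (measurableSet_lt measurable_const (by fun_prop))
    (Continuous.aestronglyMeasurable (by fun_prop)) (c := K / n) (d := boundD ω n t) (by positivity)
    hD0 (fun _ => norm_nonneg _) (fun x hx => ?_) (fun x => ?_)
  · refine h.trans (le_of_eq ?_)
    rw [boundA, setIntegral_const, smul_eq_mul, mul_one, boundC, ← hK, hspec.apply_zero,
      Real.sqrt_mul measureReal_nonneg, Real.sqrt_sq hK0]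
    ring
  · refine (norm_exp_sub_sum_sinc_le hb0 hz1 hr hbz ?_).trans hKle
    have hx' : |x| ≤ Λ := not_lt.1 hx
    rw [abs_div, abs_mul, abs_of_pos hpi, abs_of_pos hω, mul_div_assoc]
    gcongr
  · have h1 : ‖Complex.exp (b * (Real.pi * x / ω : ℝ) * Complex.I)‖ = 1 := by
      exact_mod_cast Complex.norm_exp_ofReal_mul_I (b * (Real.pi * x / ω))
    refine (norm_sub_le _ _).trans ((add_le_add h1.le
      (norm_sum_sinc_le (Real.pi * x / ω) hb0.le hbn')).trans (le_of_eq ?_))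
    rw [boundD, ← hb, hsin]
    norm_num
    ring
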